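/- Fix an integer $k\ge 1$. A $k$-sorted Boolean relation is a relation $\rho\subseteq\{0,1\}^n$ ($n\ge 0$) together with a sort in $\{1,\dots,k\}$ for each of its $n$ coordinates (variables); write $R^k$ for the set of all of them. For $S\subseteq R^k$, let $\mathrm{qpp}(S)$ be the set of all relations in $R^k$ definable by a formula built from relations in $S$, the $0$-ary false relation and the equality relations $x^i=y^i$ of the sorts $i\in\{1,\dots,k\}$, using conjunction, existential quantification and universal quantification, where every variable has one fixed sort and may only be substituted in places of that sort. A set $C\subseteq R^k$ is a quantified relational clone if $\mathrm{qpp}(C)=C$. Superscripts denote the sorts of variables, distinct symbols denote distinct variables, and addition is modulo $2$. Let $CR^k\subseteq R^k$ be the set of canonical relations, i.e. the relations without dummy variables that, up to the order of their variables, have one of the following forms, where $i,j$ range over $\{1,\dots,k\}$ and $b$ over $\{0,1\}$: - (c1) $x^i=0\lor y^i=1$; - (c2) $x^i=y^i\lor u^j=b$; - (c3) $x^i=y^i\lor u^j=v^j$ with $i\ne j$, and $x^i=y^i\lor y^i=z^i$; - (c4) $x^i+y^i=1$; - (c5) $x^i+y^i=u^j+v^j$; - (c6) $x^{s_1}+\dots+x^{s_n}=b$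 with $n\ge 2$ and pairwise distinct sorts $s_1,\dots,s_n$; - (c7) $\bigvee_{p=1}^n\bigvee_{q=1}^{m_p} x_q^{s_p}=b_p$ with $n\geq 0$, pairwise distinct sorts $s_1,\dots,s_n$, integers $m_1,\dots,m_n\ge 1$ and $b_1,\dots,b_n\in\{0,1\}$ (for $n=0$ this is the $0$-ary false relation). Theorem. For every $S\subseteq R^k$, $$\mathrm{qpp}(S)=\mathrm{qpp}\bigl(\mathrm{qpp}(S)\cap CR^k\bigr).$$ Consequently, every quantified relational clone $C\subseteq R^k$ satisfies $C=\mathrm{qpp}(C\cap CR^k)$. -/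

import Mathlib

/-- A `k`-sorted relation (predicate) on `A`: an arity, a sort for every variable, and the set of
tuples satisfying the predicate. -/
@[ext]
structure SortedRel (A : Type) (k : ℕ) where
  arity : ℕ
  sort : Fin arity → Fin k
  tuples : Set (Fin arity → A)

namespace SortedRel

/-- The predicate of arity `0` that is constantly false. -/
def bot (A : Type) (k : ℕ) : SortedRel A k := ⟨0, Fin.elim0, ∅⟩

/-- The equality predicate on two variables of sort `i`. -/
def eq (A : Type) {k : ℕ} (i : Fin k) : SortedRel A k := ⟨2, ![i, i], {a | a 0 = a 1}⟩

/-- The predicates that may always be used in formulas: false, and equality on every sort. -/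
def basic (A : Type) (k : ℕ) : Set (SortedRel A k) := {bot A k} ∪ Set.range (eq A)

/-- The `i`-th variable of `ρ` is dummy. -/
def IsDummy {A : Type} {k : ℕ} (ρ : SortedRel A k) (i : Fin ρ.arity) : Prop :=
  ∀ (a : Fin ρ.arity → A) (c : A), a ∈ ρ.tuples ↔ Function.update a i c ∈ ρ.tuples

/-- Up to an order of its variables, `ρ` is the relation defined by the condition `P` on variables
indexed by `V`, the variable `v` being of sort `τ v`. -/
def IsExpressedBy {A : Type} {k : ℕ} (ρ : SortedRel A k) {V : Type} (τ : V → Fin k)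
    (P : (V → A) → Prop) : Prop :=
  ∃ e : Fin ρ.arity ≃ V, (∀ i, ρ.sort i = τ (e i)) ∧
    ∀ a : V → A, (fun i => a (e i)) ∈ ρ.tuples ↔ P a

end SortedRel

/-- Sorted quantified primitive positive formulas over `S`, with `n` free variables, the `i`-th of
which has sort `s i`. A quantifier binds a variable of a chosen sort `j`; in its scope this
variable has index `0` and the other indices are shifted by one. -/
inductive QppFormula {A : Type} {k : ℕ} (S : Set (SortedRel A k)) :
    (n : ℕ) → (Fin n → Fin k) → Type
  | atom {n : ℕ} {s : Fin n → Fin k} (ρ : SortedRel A k) (hρ : ρ ∈ S ∪ SortedRel.basic A k)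
      (v : Fin ρ.arity → Fin n) (hv : ∀ i, s (v i) = ρ.sort i) : QppFormula S n s
  | and {n : ℕ} {s : Fin n → Fin k} (φ ψ : QppFormula S n s) : QppFormula S n s
  | ex {n : ℕ} {s : Fin n → Fin k} (j : Fin k)
      (φ : QppFormula S (n + 1) (Matrix.vecCons j s)) : QppFormula S n s
  | all {n : ℕ} {s : Fin n → Fin k} (j : Fin k)
      (φ : QppFormula S (n + 1) (Matrix.vecCons j s)) : QppFormula S n s

/-- Truth of a formula under an assignment of its free variables. -/
def QppFormula.Realize {A : Type} {k : ℕ} {S : Set (SortedRel A k)} :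
    {n : ℕ} → {s : Fin n → Fin k} → QppFormula S n s → (Fin n → A) → Prop
  | _, _, .atom ρ _ v _, a => (fun i => a (v i)) ∈ ρ.tuples
  | _, _, .and φ ψ, a => φ.Realize a ∧ ψ.Realize a
  | _, _, .ex _ φ, a => ∃ c : A, φ.Realize (Matrix.vecCons c a)
  | _, _, .all _ φ, a => ∀ c : A, φ.Realize (Matrix.vecCons c a)

/-- The closure of `S` under definability by sorted quantified primitive positive formulas. -/
def qpp {A : Type} {k : ℕ} (S : Set (SortedRel A k)) : Set (SortedRel A k) :=
  {ρ | ∃ φ : QppFormula S ρ.arity ρ.sort, ∀ a, a ∈ ρ.tuples ↔ φ.Realize a}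

/-- `S` is a `k`-sorted quantified relational clone. -/
def IsQuantifiedRelClone {A : Type} {k : ℕ} (S : Set (SortedRel A k)) : Prop :=
  qpp S = S

/-- The seven shapes of canonical relations on `{0, 1}`, up to an order of variables. -/
inductive CanonicalShape {k : ℕ} (ρ : SortedRel (ZMod 2) k) : Prop
  | c1 (i : Fin k)
      (h : ρ.IsExpressedBy ![i, i] fun a => a 0 = 0 ∨ a 1 = 1)
  | c2 (i j : Fin k) (b : ZMod 2)
      (h : ρ.IsExpressedBy ![i, i, j] fun a => a 0 = a 1 ∨ a 2 = b)
  | c3 (i j : Fin k) (hij : i ≠ j)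
      (h : ρ.IsExpressedBy ![i, i, j, j] fun a => a 0 = a 1 ∨ a 2 = a 3)
  | c3_same (i : Fin k)
      (h : ρ.IsExpressedBy ![i, i, i] fun a => a 0 = a 1 ∨ a 1 = a 2)
  | c4 (i : Fin k)
      (h : ρ.IsExpressedBy ![i, i] fun a => a 0 + a 1 = 1)
  | c5 (i j : Fin k)
      (h : ρ.IsExpressedBy ![i, i, j, j] fun a => a 0 + a 1 = a 2 + a 3)
  | c6 (n : ℕ) (hn : 2 ≤ n) (s : Fin n → Fin k) (hs : Function.Injective s) (b : ZMod 2)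
      (h : ρ.IsExpressedBy s fun a => ∑ p, a p = b)
  | c7 (n : ℕ) (s : Fin n → Fin k) (hs : Function.Injective s) (b : Fin n → ZMod 2)
      (m : Fin n → ℕ) (hm : ∀ p, 1 ≤ m p)
      (h : ρ.IsExpressedBy (V := Σ p : Fin n, Fin (m p)) (fun v => s v.1)
        fun a => ∃ v, a v = b v.1)

/-- The set of all `k`-sorted canonical relations on `{0, 1}`. -/
def CR (k : ℕ) : Set (SortedRel (ZMod 2) k) :=
  {ρ | (∀ i, ¬ ρ.IsDummy i) ∧ CanonicalShape ρ}

/-! Only the inclusion of `qpp S` in `qpp (qpp S ∩ CR k)` has content. It suffices to separate: for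
each point `α` outside a definable `P`, find a predicate containing `P`, omitting `α` and definable
from canonical relations (`exists_canonical_separating`). `P` is the finite conjunction of these.

If flipping some coordinate of `α` stays outside `P`, project that coordinate away and induct.
Otherwise enlarge `P` to a maximal definable predicate omitting `α`. Maximality makes it invariant
under translation by `γ + α` for every `γ` outside it (`translation_of_maximal`), so its complement
is a coset of a subgroup of `𝔽₂^V`. Put in echelon form (`exists_echelon_form`), the predicate is a
disjunction of linear equations, each with its own pivot variable.

Such a disjunction breaks up into canonical relations (`echelon_canonical`): universal
quantification over pivots isolates small subsets of equations, existential quantification extracts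
the shapes (c1)–(c5) from them, and chains of equalities reassemble the whole. Single equations
reduce to (c4)–(c6) by `sum_canonical`; clauses are (c7) unless literals of one sort disagree. -/

/-! ### Substitution in formulas. -/

namespace QppFormula

variable {A : Type} {k : ℕ} {S T : Set (SortedRel A k)}

/-- The map `f` is arbitrary, so this covers permuting, identifying and adding variables. Under a
quantifier it is extended to fix the bound index `0`. -/
theorem exists_rename {n : ℕ} {s : Fin n → Fin k} (φ : QppFormula S n s) :
    ∀ {m : ℕ} {t : Fin m → Fin k} (f : Fin n → Fin m), (∀ i, t (f i) = s i) →
      ∃ ψ : QppFormula S m t, ∀ a, ψ.Realize a ↔ φ.Realize (a ∘ f) := by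
  have lift {n m : ℕ} {s : Fin n → Fin k} {t : Fin m → Fin k} {f : Fin n → Fin m}
      (hf : ∀ i, t (f i) = s i) (j : Fin k) (i : Fin (n + 1)) :
      (Matrix.vecCons j t : Fin (m + 1) → Fin k)
        ((Fin.cons 0 (Fin.succ ∘ f) : Fin (n + 1) → Fin (m + 1)) i) =
        (Matrix.vecCons j s : Fin (n + 1) → Fin k) i := by
    refine Fin.cases ?_ (fun i => ?_) i <;> simp [hf]
  have comp {n m : ℕ} (f : Fin n → Fin m) (c : A) (a : Fin m → A) :
      (Matrix.vecCons c a : Fin (m + 1) → A) ∘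
        (Fin.cons 0 (Fin.succ ∘ f) : Fin (n + 1) → Fin (m + 1)) = Matrix.vecCons c (a ∘ f) := by
    funext i
    refine Fin.cases ?_ (fun i => ?_) i <;> simp
  induction φ with
  | atom ρ hρ v hv =>
    intro m t f hf
    exact ⟨.atom ρ hρ (f ∘ v) fun i => (hf _).trans (hv i), fun a => Iff.rfl⟩
  | and φ ψ ihφ ihψ =>
    intro m t f hf
    obtain ⟨φ', hφ⟩ := ihφ f hf
    obtain ⟨ψ', hψ⟩ := ihψ f hf
    exact ⟨.and φ' ψ', fun a => and_congr (hφ a) (hψ a)⟩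
  | ex j φ ih =>
    intro m t f hf
    obtain ⟨φ', hφ⟩ := ih _ (lift hf j)
    refine ⟨.ex j φ', fun a => exists_congr fun c => ?_⟩
    rw [hφ, comp]
  | all j φ ih =>
    intro m t f hf
    obtain ⟨φ', hφ⟩ := ih _ (lift hf j)
    refine ⟨.all j φ', fun a => forall_congr' fun c => ?_⟩
    rw [hφ, comp]

theorem exists_of_subset_qpp (hT : T ⊆ qpp S) {n : ℕ} {s : Fin n → Fin k}
    (φ : QppFormula T n s) : ∃ ψ : QppFormula S n s, ∀ a, ψ.Realize a ↔ φ.Realize a := by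
  induction φ with
  | atom ρ hρ v hv =>
    rcases hρ with hρ | hρ
    · obtain ⟨φ, hφ⟩ := hT hρ
      obtain ⟨ψ, hψ⟩ := φ.exists_rename v hv
      exact ⟨ψ, fun a => (hψ a).trans (hφ _).symm⟩
    · exact ⟨.atom ρ (Or.inr hρ) v hv, fun a => Iff.rfl⟩
  | and φ ψ ihφ ihψ =>
    obtain ⟨φ', hφ⟩ := ihφ
    obtain ⟨ψ', hψ⟩ := ihψ
    exact ⟨.and φ' ψ', fun a => and_congr (hφ a) (hψ a)⟩
  | ex j φ ih =>
    obtain ⟨φ', hφ⟩ := ih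
    exact ⟨.ex j φ', fun a => exists_congr fun c => hφ _⟩
  | all j φ ih =>
    obtain ⟨φ', hφ⟩ := ih
    exact ⟨.all j φ', fun a => forall_congr' fun c => hφ _⟩

end QppFormula

theorem qpp_subset_of_subset_qpp {A : Type} {k : ℕ} {S T : Set (SortedRel A k)}
    (hT : T ⊆ qpp S) : qpp T ⊆ qpp S := by
  rintro ρ ⟨φ, hφ⟩
  obtain ⟨ψ, hψ⟩ := φ.exists_of_subset_qpp hT
  exact ⟨ψ, fun a => (hφ a).trans (hψ a).symm⟩

/-! ### Definability with variables indexed by an arbitrary finite type. -/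

/-- The predicate `P` in variables indexed by `V`, with sorts `τ`, is defined by a sorted
quantified primitive positive formula over `S`. -/
def Definable {A : Type} {k : ℕ} (S : Set (SortedRel A k)) {V : Type} (τ : V → Fin k)
    (P : (V → A) → Prop) : Prop :=
  ∃ (n : ℕ) (e : Fin n ≃ V) (φ : QppFormula S n (τ ∘ e)), ∀ a, P a ↔ φ.Realize (a ∘ e)

namespace Definable

variable {A : Type} {k : ℕ} {S T : Set (SortedRel A k)} {V W U : Type} {τ : V → Fin k}
  {P Q : (V → A) → Prop}

theorem congr (h : Definable S τ P) (hPQ : ∀ a, Q a ↔ P a) : Definable S τ Q := by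
  rwa [show Q = P from funext fun a => propext (hPQ a)]

theorem finite (h : Definable S τ P) : Finite V :=
  let ⟨_, e, _⟩ := h
  .of_equiv _ e

theorem exists_formula_of_equiv (h : Definable S τ P) {m : ℕ} (e : Fin m ≃ V) :
    ∃ φ : QppFormula S m (τ ∘ e), ∀ a, P a ↔ φ.Realize (a ∘ e) := by
  obtain ⟨n, e', φ, hφ⟩ := h
  obtain ⟨ψ, hψ⟩ := φ.exists_rename (t := τ ∘ e) (e.symm ∘ e') (by simp)
  refine ⟨ψ, fun a => ?_⟩
  rw [hφ, hψ]
  simp [Function.comp_def]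

theorem rename [Finite W] (h : Definable S τ P) {υ : W → Fin k} (f : V → W)
    (hf : ∀ v, υ (f v) = τ v) : Definable S υ fun a => P fun v => a (f v) := by
  obtain ⟨n, e, φ, hφ⟩ := h
  obtain ⟨m, ⟨e'⟩⟩ := Finite.exists_equiv_fin W
  obtain ⟨ψ, hψ⟩ := φ.exists_rename (t := υ ∘ e'.symm) (e' ∘ f ∘ e) (by simp [hf])
  refine ⟨m, e'.symm, ψ, fun a => ?_⟩
  refine (hφ _).trans (Iff.trans ?_ (hψ _).symm)
  simp [Function.comp_def]

theorem and (hP : Definable S τ P) (hQ : Definable S τ Q) :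
    Definable S τ fun a => P a ∧ Q a := by
  obtain ⟨n, e, φ, hφ⟩ := hP
  obtain ⟨ψ, hψ⟩ := hQ.exists_formula_of_equiv e
  exact ⟨n, e, .and φ ψ, fun a => and_congr (hφ a) (hψ a)⟩

/-- Translates between the two conventions for a bound variable: `none` in `Option V`, index `0` in
a formula. -/
theorem exists_quantifier_formula {j : Fin k} {P : (Option V → A) → Prop} [Finite V]
    (h : Definable S (fun o => o.elim j τ) P) :
    ∃ (n : ℕ) (e : Fin n ≃ V) (φ : QppFormula S (n + 1) (Matrix.vecCons j (τ ∘ e))),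
      ∀ a c, P (fun o => o.elim c a) ↔ φ.Realize (Matrix.vecCons c (a ∘ e)) := by
  obtain ⟨n, ⟨e⟩⟩ := Finite.exists_equiv_fin V
  obtain ⟨φ, hφ⟩ := h.exists_formula_of_equiv ((finSuccEquiv n).trans e.symm.optionCongr)
  obtain ⟨ψ, hψ⟩ := φ.exists_rename (t := Matrix.vecCons j (τ ∘ e.symm)) id (fun i => by
    refine Fin.cases ?_ (fun i => ?_) i <;> simp <;> rfl)
  refine ⟨n, e.symm, ψ, fun a c => ?_⟩
  rw [hφ, hψ]
  refine iff_of_eq (congrArg _ (funext fun i => ?_))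
  refine Fin.cases ?_ (fun i => ?_) i <;> simp <;> rfl

theorem ex [Finite V] {j : Fin k} {P : (Option V → A) → Prop}
    (h : Definable S (fun o => o.elim j τ) P) :
    Definable S τ fun a => ∃ c, P fun o => o.elim c a := by
  obtain ⟨n, e, φ, hφ⟩ := h.exists_quantifier_formula
  exact ⟨n, e, .ex j φ, fun a => exists_congr fun c => hφ a c⟩

theorem all [Finite V] {j : Fin k} {P : (Option V → A) → Prop}
    (h : Definable S (fun o => o.elim j τ) P) :
    Definable S τ fun a => ∀ c, P fun o => o.elim c a := by
  obtain ⟨n, e, φ, hφ⟩ := h.exists_quantifier_formula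
  exact ⟨n, e, .all j φ, fun a => forall_congr' fun c => hφ a c⟩

theorem exs [Finite V] [Finite U] : ∀ {υ : U → Fin k} {P : (V ⊕ U → A) → Prop},
    Definable S (Sum.elim τ υ) P → Definable S τ fun a => ∃ u, P (Sum.elim a u) := by
  induction U using Finite.induction_empty_option with
  | @of_equiv α β e ih =>
    intro υ P h
    have := h.finite
    have : Finite (V ⊕ α) := .of_equiv _ (Equiv.sumCongr (Equiv.refl V) e.symm)
    refine (ih (h.rename (υ := Sum.elim τ (υ ∘ e)) (Sum.map id e.symm)
      (by rintro (v | u) <;> simp))).congr fun a => ⟨?_, ?_⟩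
    · rintro ⟨u, hu⟩
      refine ⟨u ∘ e, ?_⟩
      convert hu using 1
      funext x
      rcases x with x | x <;> simp
    · rintro ⟨u, hu⟩
      refine ⟨u ∘ e.symm, ?_⟩
      convert hu using 1
      funext x
      rcases x with x | x <;> simp
  | h_empty =>
    intro υ P h
    refine (h.rename (υ := τ) (Sum.elim id PEmpty.elim)
      (by rintro (v | u); exacts [rfl, u.elim])).congr fun a => ⟨?_, fun hu => ⟨PEmpty.elim, ?_⟩⟩
    · rintro ⟨u, hu⟩
      convert hu using 1
      funext x
      rcases x with x | x
      exacts [rfl, x.elim]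
    · convert hu using 1
      funext x
      rcases x with x | x
      exacts [rfl, x.elim]
  | @h_option α _ ih =>
    intro υ P h
    let f : V ⊕ Option α → Option (V ⊕ α) := fun x =>
      x.elim (some ∘ Sum.inl) fun o => o.elim none (some ∘ Sum.inr)
    refine (ih ((h.rename (υ := fun o => o.elim (υ none) (Sum.elim τ (υ ∘ some))) f
      ?_).ex)).congr fun a => ⟨?_, ?_⟩
    · rintro (v | _ | u) <;> rfl
    · rintro ⟨u, hu⟩
      refine ⟨u ∘ some, u none, ?_⟩
      convert hu using 1
      funext x
      rcases x with x | _ | x <;> rfl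
    · rintro ⟨u, c, hu⟩
      refine ⟨fun o => o.elim c u, ?_⟩
      convert hu using 1
      funext x
      rcases x with x | _ | x <;> rfl

theorem alls [Finite V] [Finite U] : ∀ {υ : U → Fin k} {P : (V ⊕ U → A) → Prop},
    Definable S (Sum.elim τ υ) P → Definable S τ fun a => ∀ u, P (Sum.elim a u) := by
  induction U using Finite.induction_empty_option with
  | @of_equiv α β e ih =>
    intro υ P h
    have := h.finite
    have : Finite (V ⊕ α) := .of_equiv _ (Equiv.sumCongr (Equiv.refl V) e.symm)
    refine (ih (h.rename (υ := Sum.elim τ (υ ∘ e)) (Sum.map id e.symm)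
      (by rintro (v | u) <;> simp))).congr fun a => ⟨fun hu u => ?_, fun hu u => ?_⟩
    · convert hu (u ∘ e.symm) using 1
      funext x
      rcases x with x | x <;> simp
    · convert hu (u ∘ e) using 1
      funext x
      rcases x with x | x <;> simp
  | h_empty =>
    intro υ P h
    refine (h.rename (υ := τ) (Sum.elim id PEmpty.elim)
      (by rintro (v | u); exacts [rfl, u.elim])).congr fun a => ⟨fun hu => ?_, fun hu u => ?_⟩
    · convert hu PEmpty.elim using 1
      funext x
      rcases x with x | x
      exacts [rfl, x.elim]
    · convert hu using 1
      funext x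
      rcases x with x | x
      exacts [rfl, x.elim]
  | @h_option α _ ih =>
    intro υ P h
    let f : V ⊕ Option α → Option (V ⊕ α) := fun x =>
      x.elim (some ∘ Sum.inl) fun o => o.elim none (some ∘ Sum.inr)
    refine (ih ((h.rename (υ := fun o => o.elim (υ none) (Sum.elim τ (υ ∘ some))) f
      ?_).all)).congr fun a => ⟨fun hu u c => ?_, fun hu u => ?_⟩
    · rintro (v | _ | u) <;> rfl
    · convert hu (fun o => o.elim c u) using 1
      funext x
      rcases x with x | _ | x <;> rfl
    · convert hu (u ∘ some) (u none) using 1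
      funext x
      rcases x with x | _ | x <;> rfl

theorem eq [Finite V] {u v : V} (h : τ u = τ v) : Definable S τ fun a => a u = a v := by
  obtain ⟨n, ⟨e⟩⟩ := Finite.exists_equiv_fin V
  refine ⟨n, e.symm, .atom (SortedRel.eq A (τ u)) (Or.inr (Or.inr ⟨_, rfl⟩)) ![e u, e v] ?_, ?_⟩
  · intro i
    fin_cases i <;> simp [SortedRel.eq, h]
  · intro a
    change a u = a v ↔ a (e.symm (e u)) = a (e.symm (e v))
    simp

theorem false [Finite V] : Definable S τ fun _ => False := by
  obtain ⟨n, ⟨e⟩⟩ := Finite.exists_equiv_fin V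
  exact ⟨n, e.symm, .atom (SortedRel.bot A k) (Or.inr (Or.inl rfl)) Fin.elim0 (fun i => i.elim0),
    fun a => Iff.rfl⟩

/-- Truth is expressed as `∃ c, c = c`, which also works when `V` is empty; `NeZero k` supplies a
sort for `c`. -/
theorem true [Finite V] [NeZero k] [Nonempty A] : Definable S τ fun _ => True :=
  (ex (τ := τ) (j := 0) (eq (u := none) (v := none) rfl)).congr fun _ => by simp

theorem forall_finite [Finite V] [NeZero k] [Nonempty A] {ι : Type} [Finite ι]
    {P : ι → (V → A) → Prop} (h : ∀ i, Definable S τ (P i)) :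
    Definable S τ fun a => ∀ i, P i a := by
  induction ι using Finite.induction_empty_option with
  | of_equiv e ih => exact (ih fun i => h (e i)).congr fun a => e.forall_congr_right.symm
  | h_empty => exact true.congr fun a => by simp
  | h_option ih => exact ((h none).and (ih fun i => h (some i))).congr fun a => Option.forall

theorem imp_const [Finite V] [NeZero k] [Nonempty A] {p : Prop} (h : p → Definable S τ P) :
    Definable S τ fun a => p → P a := by
  by_cases hp : p
  · exact (h hp).congr fun a => by simp [hp]
  · exact true.congr fun a => by simp [hp]

theorem mem_qpp_iff {ρ : SortedRel A k} :
    ρ ∈ qpp S ↔ Definable S ρ.sort (· ∈ ρ.tuples) := by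
  refine ⟨fun ⟨φ, hφ⟩ => ⟨_, Equiv.refl _, φ, hφ⟩, fun h => ?_⟩
  obtain ⟨φ, hφ⟩ := h.exists_formula_of_equiv (Equiv.refl _)
  exact ⟨φ, hφ⟩

/-- Projection to the variables in the image of `g`. -/
theorem proj [Finite V] [Finite W] [NeZero k] [Nonempty A] (h : Definable S τ P) (g : W → V) :
    Definable S (τ ∘ g) fun a => ∃ x, P x ∧ ∀ w, x (g w) = a w := by
  have h1 := h.rename (υ := Sum.elim (τ ∘ g) τ) Sum.inr fun _ => rfl
  have h2 := forall_finite fun w => eq (S := S) (A := A) (τ := Sum.elim (τ ∘ g) τ)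
    (u := Sum.inr (g w)) (v := Sum.inl w) rfl
  exact (h1.and h2).exs

end Definable

/-! ### Reindexing of shapes and arithmetic modulo 2. -/

namespace SortedRel

theorem IsExpressedBy.reindex {A : Type} {k : ℕ} {ρ : SortedRel A k} {V W : Type} {τ : V → Fin k}
    {υ : W → Fin k} {P : (V → A) → Prop} {Q : (W → A) → Prop} (h : ρ.IsExpressedBy τ P)
    (f : V ≃ W) (hf : ∀ v, τ v = υ (f v)) (hPQ : ∀ a, Q a ↔ P fun v => a (f v)) :
    ρ.IsExpressedBy υ Q := by
  obtain ⟨e, h1, h2⟩ := h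
  exact ⟨e.trans f, fun i => (h1 i).trans (hf _), fun a => (h2 _).trans (hPQ a).symm⟩

end SortedRel

theorem ZMod.two_eq_or_eq_of_ne {a b : ZMod 2} (h : a ≠ b) (c : ZMod 2) : c = a ∨ c = b := by
  revert a b c; decide

theorem ZMod.two_eq_add_one_of_ne {a b : ZMod 2} (h : a ≠ b) : a = b + 1 := by
  revert a b; decide

theorem exists_sum_eq {V R : Type} [DecidableEq V] [AddCommMonoid R] {T : Finset V}
    (hT : T.Nonempty) (c : R) : ∃ x : V → R, ∑ v ∈ T, x v = c := by
  obtain ⟨j, hj⟩ := hT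
  exact ⟨Pi.single j c, by simp [hj]⟩

theorem sum_update_add_one {V : Type} [DecidableEq V] {T : Finset V} (x : V → ZMod 2) {v : V}
    (hv : v ∈ T) : ∑ u ∈ T, Function.update x v (x v + 1) u = ∑ u ∈ T, x u + 1 := by
  rw [Finset.sum_update_of_mem hv, ← Finset.add_sum_erase _ _ hv, Finset.sdiff_singleton_eq_erase]
  ring

/-! ### Predicates that are canonical as they stand. -/

namespace Definable

variable {k : ℕ} {S T : Set (SortedRel (ZMod 2) k)} {V : Type} {τ : V → Fin k}
  {P : (V → ZMod 2) → Prop}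

/-- A point outside `P` all of whose neighbours lie in `P` certifies that no variable is dummy. The
relation of `P` is then itself in `qpp S ∩ CR k`, and a single atom defines `P`. -/
theorem canonical [DecidableEq V] (h : Definable S τ P)
    (hshape : ∀ ρ : SortedRel (ZMod 2) k, ρ.IsExpressedBy τ P → CanonicalShape ρ)
    {α : V → ZMod 2} (hα : ¬ P α) (hflip : ∀ v, P (Function.update α v (α v + 1))) :
    Definable (qpp S ∩ CR k) τ P := by
  obtain ⟨n, e, φ, hφ⟩ := h
  let ρ : SortedRel (ZMod 2) k := ⟨n, τ ∘ e, {x | P (x ∘ e.symm)}⟩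
  have hP (a : V → ZMod 2) : (a ∘ e) ∘ e.symm = a := by
    simp [Function.comp_assoc]
  have hρ : ρ ∈ qpp S ∩ CR k := by
    refine ⟨⟨φ, fun a => ?_⟩, fun i hi => ?_, hshape ρ ⟨e, fun _ => rfl, fun a => ?_⟩⟩
    · exact (hφ _).trans (by simp [Function.comp_assoc, ρ])
    · have h1 := hi (α ∘ e) (α (e i) + 1)
      refine hα ?_
      have h2 : P (Function.update (α ∘ e) i (α (e i) + 1) ∘ e.symm) := by
        rw [Function.update_comp_equiv, hP, Equiv.symm_symm]
        exact hflip _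
      have h3 : P ((α ∘ e) ∘ e.symm) := h1.2 h2
      rwa [hP] at h3
    · change P ((a ∘ e) ∘ e.symm) ↔ P a
      rw [hP]
  refine ⟨n, e, .atom ρ (Or.inl hρ) id fun _ => rfl, fun a => ?_⟩
  change P a ↔ P ((a ∘ e) ∘ e.symm)
  rw [hP]

theorem le_canonical {i : Fin k}
    (h : Definable S ![i, i] fun a : Fin 2 → ZMod 2 => a 0 = 0 ∨ a 1 = 1) :
    Definable (qpp S ∩ CR k) ![i, i] fun a : Fin 2 → ZMod 2 => a 0 = 0 ∨ a 1 = 1 :=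
  h.canonical (fun _ hρ => .c1 i hρ) (α := ![1, 0]) (by decide) (by decide)

theorem eq_or_const_canonical {i j : Fin k} {b : ZMod 2}
    (h : Definable S ![i, i, j] fun a : Fin 3 → ZMod 2 => a 0 = a 1 ∨ a 2 = b) :
    Definable (qpp S ∩ CR k) ![i, i, j] fun a : Fin 3 → ZMod 2 => a 0 = a 1 ∨ a 2 = b :=
  h.canonical (fun _ hρ => .c2 i j b hρ) (α := ![1, 0, b + 1])
    (by clear h; revert b; decide) (by clear h; revert b; decide)

theorem sum_eq_sum_canonical {i j : Fin k}
    (h : Definable S ![i, i, j, j] fun a : Fin 4 → ZMod 2 => a 0 + a 1 = a 2 + a 3) :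
    Definable (qpp S ∩ CR k) ![i, i, j, j] fun a : Fin 4 → ZMod 2 => a 0 + a 1 = a 2 + a 3 :=
  h.canonical (fun _ hρ => .c5 i j hρ) (α := ![1, 0, 0, 0]) (by decide) (by decide)

theorem ne_canonical {i : Fin k}
    (h : Definable S ![i, i] fun a : Fin 2 → ZMod 2 => a 0 + a 1 = 1) :
    Definable (qpp S ∩ CR k) ![i, i] fun a : Fin 2 → ZMod 2 => a 0 + a 1 = 1 :=
  h.canonical (fun _ hρ => .c4 i hρ) (α := ![0, 0]) (by decide) (by decide)

/-- Linking two copies through `t` gives `a 0 = a 1 ∨ a 2 = a 3 ∨ a 1 = a 2`. Exchanging the last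
two variables replaces `a 1 = a 2` by `a 1 = a 3`; if `a 2 ≠ a 3`, both cannot hold. -/
theorem eq_or_eq_of_three {i : Fin k}
    (h : Definable S ![i, i, i] fun a : Fin 3 → ZMod 2 => a 0 = a 1 ∨ a 1 = a 2) :
    Definable S ![i, i, i, i] fun a : Fin 4 → ZMod 2 => a 0 = a 1 ∨ a 2 = a 3 := by
  have h1 := h.rename (υ := fun o : Option (Fin 4) => o.elim i ![i, i, i, i])
    ![some 0, some 1, none] (by simp [Fin.forall_fin_succ])
  have h2 := h.rename (υ := fun o : Option (Fin 4) => o.elim i ![i, i, i, i])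
    ![none, some 2, some 3] (by simp [Fin.forall_fin_succ])
  have h3 := (h1.and h2).ex
  have h4 := h3.rename (υ := ![i, i, i, i]) ![0, 1, 3, 2] (by simp [Fin.forall_fin_succ])
  refine (h3.and h4).congr fun a => ?_
  simp only [Matrix.cons_val, Option.elim]
  generalize a 0 = w, a 1 = x, a 2 = y, a 3 = z
  revert w x y z
  decide

theorem eq_or_eq_canonical {i j : Fin k}
    (h : Definable S ![i, i, j, j] fun a : Fin 4 → ZMod 2 => a 0 = a 1 ∨ a 2 = a 3) :
    Definable (qpp S ∩ CR k) ![i, i, j, j] fun a : Fin 4 → ZMod 2 => a 0 = a 1 ∨ a 2 = a 3 := by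
  by_cases hij : i = j
  · subst hij
    have h1 := h.rename (υ := ![i, i, i]) ![0, 1, 1, 2] (by simp [Fin.forall_fin_succ])
    exact eq_or_eq_of_three (h1.canonical (fun _ hρ => .c3_same i hρ) (α := ![0, 1, 0])
      (by decide) (by decide))
  · exact h.canonical (fun _ hρ => .c3 i j hij hρ) (α := ![0, 1, 0, 1])
      (by decide) (by decide)

theorem clause_univ_canonical [Finite V] {b : V → ZMod 2} (hb : ∀ u v, τ u = τ v → b u = b v)
    (h : Definable S τ fun a : V → ZMod 2 => ∃ v, a v = b v) :
    Definable (qpp S ∩ CR k) τ fun a : V → ZMod 2 => ∃ v, a v = b v := by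
  classical
  have := Fintype.ofFinite V
  refine h.canonical (fun ρ hρ => ?_) (α := fun v => b v + 1) (by simp) ?_
  · obtain ⟨n, ⟨r⟩⟩ := Finite.exists_equiv_fin (Set.range τ)
    let f : V → Fin n := fun v => r ⟨τ v, v, rfl⟩
    let s : Fin n → Fin k := fun p => (r.symm p).1
    have hsf (v : V) : s (f v) = τ v := by simp [s, f]
    have hf : f.Surjective := fun p => by
      obtain ⟨v, hv⟩ := (r.symm p).2
      exact ⟨v, by simp [f, hv]⟩
    let e : V ≃ Σ p : Fin n, Fin (Fintype.card {v // f v = p}) :=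
      (Equiv.sigmaFiberEquiv f).symm.trans (Equiv.sigmaCongrRight fun p => Fintype.equivFin _)
    have he (v : V) : (e v).1 = f v := rfl
    refine .c7 n s (Subtype.val_injective.comp r.symm.injective)
      (fun p => b (Function.surjInv hf p)) (fun p => Fintype.card {v // f v = p}) (fun p => ?_)
      (hρ.reindex e (fun v => by rw [he, hsf]) fun a => ?_)
    · obtain ⟨v, hv⟩ := hf p
      exact Fintype.card_pos_iff.2 ⟨⟨v, hv⟩⟩
    · rw [← e.exists_congr_right]
      refine exists_congr fun v => ?_
      rw [he, hb (Function.surjInv hf (f v)) v]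
      rw [← hsf, ← hsf v, Function.surjInv_eq hf]
  · intro v
    refine ⟨v, ?_⟩
    simp only [Function.update_self]
    generalize b v = c
    revert c
    decide

theorem sum_univ_canonical_of_injective [Fintype V] {b : ZMod 2} (hτ : τ.Injective)
    (hV : Nonempty V) (h : Definable S τ fun a : V → ZMod 2 => ∑ v, a v = b) :
    Definable (qpp S ∩ CR k) τ fun a : V → ZMod 2 => ∑ v, a v = b := by
  classical
  -- Shape (c6) needs two variables; an equation in one variable is a clause of shape (c7).
  rcases subsingleton_or_nontrivial V with hs | hs
  · obtain ⟨v₀⟩ := hV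
    have key (a : V → ZMod 2) : ∑ v, a v = b ↔ ∃ v, a v = b := by
      rw [Fintype.sum_subsingleton _ v₀]
      exact ⟨fun h => ⟨v₀, h⟩, fun ⟨v, hv⟩ => Subsingleton.elim v v₀ ▸ hv⟩
    exact (clause_univ_canonical (fun _ _ _ => rfl) (h.congr fun a => (key a).symm)).congr key
  · obtain ⟨x, hx⟩ := exists_sum_eq (V := V) Finset.univ_nonempty (b + 1)
    refine h.canonical (fun ρ hρ => ?_) (α := x) (by simp [hx]) ?_
    · have e := Fintype.equivFin V
      refine .c6 (Fintype.card V) Fintype.one_lt_card (τ ∘ e.symm) (hτ.comp e.symm.injective) b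
        (hρ.reindex e (by simp) fun a => ?_)
      rw [e.sum_comp]
    · intro v
      rw [sum_update_add_one x (Finset.mem_univ v), hx, add_assoc, CharTwo.add_self_eq_zero,
        add_zero]

end Definable

/-! ### Clauses and single linear equations. -/

namespace Definable

variable {k : ℕ} {S T : Set (SortedRel (ZMod 2) k)} {V : Type} {τ : V → Fin k}
  {P : (V → ZMod 2) → Prop}

theorem const [Finite V] [NeZero k] (p : Prop) : Definable S τ fun _ : V → ZMod 2 => p := by
  by_cases hp : p
  · exact true.congr fun _ => by simp [hp]
  · exact false.congr fun _ => by simp [hp]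

theorem clause_canonical [Finite V] [NeZero k] {R : Finset V} {b : V → ZMod 2}
    (hb : ∀ u ∈ R, ∀ v ∈ R, τ u = τ v → b u = b v)
    (h : Definable S τ fun a : V → ZMod 2 => ∃ v ∈ R, a v = b v) :
    Definable (qpp S ∩ CR k) τ fun a : V → ZMod 2 => ∃ v ∈ R, a v = b v := by
  classical
  have h1 : Definable S (τ ∘ Subtype.val) fun a : R → ZMod 2 => ∃ v, a v = b v :=
    (h.proj Subtype.val).congr fun a => by
      refine ⟨fun ⟨v, hv⟩ => ⟨fun u => if hu : u ∈ R then a ⟨u, hu⟩ else 0, ⟨v, v.2, by simp [hv]⟩,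
        by simp⟩, fun ⟨x, ⟨v, hv, hx⟩, hxa⟩ => ⟨⟨v, hv⟩, by rw [← hxa, hx]⟩⟩
  exact ((clause_univ_canonical (fun u v => hb u.1 u.2 v.1 v.2) h1).rename (υ := τ)
    Subtype.val fun _ => rfl).congr fun a => by simp

theorem sum_canonical_of_injOn [Finite V] [NeZero k] {R : Finset V} {b : ZMod 2}
    (hτ : Set.InjOn τ R) (h : Definable S τ fun a : V → ZMod 2 => ∑ v ∈ R, a v = b) :
    Definable (qpp S ∩ CR k) τ fun a : V → ZMod 2 => ∑ v ∈ R, a v = b := by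
  classical
  rcases R.eq_empty_or_nonempty with rfl | ⟨v, hv⟩
  · simpa using const _
  have h1 : Definable S (τ ∘ Subtype.val) fun a : R → ZMod 2 => ∑ v, a v = b :=
    (h.proj Subtype.val).congr fun a => by
      refine ⟨fun hv => ⟨fun u => if hu : u ∈ R then a ⟨u, hu⟩ else 0, ?_, by simp⟩,
        fun ⟨x, hx, hxa⟩ => ?_⟩
      · rw [← Finset.sum_coe_sort]
        simpa using hv
      · rw [← Finset.sum_coe_sort] at hx
        simpa [hxa] using hx
  exact ((sum_univ_canonical_of_injective (fun u v huv => Subtype.ext (hτ u.2 v.2 huv))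
    ⟨⟨v, hv⟩⟩ h1).rename Subtype.val fun _ => rfl).congr fun a => by
      rw [← Finset.sum_coe_sort]; rfl

/-- Two copies of the equation share all variables but `u` and `w`. The shared sum contains `v`, so
it takes any value, and eliminating it leaves `a 0 + a 2 = a 1 + a 3`. -/
theorem sum_eq_sum_of_sum [Finite V] [DecidableEq V] {R : Finset V} {b : ZMod 2} {u v w : V}
    (hu : u ∈ R) (hv : v ∈ R) (hw : w ∈ R) (huv : u ≠ v) (huw : u ≠ w) (hvw : v ≠ w)
    (h : Definable S τ fun a : V → ZMod 2 => ∑ v ∈ R, a v = b) :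
    Definable S ![τ u, τ u, τ w, τ w] fun a : Fin 4 → ZMod 2 => a 0 + a 1 = a 2 + a 3 := by
  let f (i j : Fin 4) : V → Fin 4 ⊕ V := fun x =>
    if x = u then .inl i else if x = w then .inl j else .inr x
  have hsum (i j : Fin 4) (a : Fin 4 → ZMod 2) (x : V → ZMod 2) :
      ∑ y ∈ R, Sum.elim a x (f i j y) = a i + (a j + ∑ y ∈ (R.erase u).erase w, x y) := by
    rw [← Finset.add_sum_erase _ _ hu, ← Finset.add_sum_erase (R.erase u) _
      (Finset.mem_erase.2 ⟨huw.symm, hw⟩)]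
    congr 1
    · simp [f]
    congr 1
    · simp [f, huw.symm]
    · refine Finset.sum_congr rfl fun y hy => ?_
      simp only [Finset.mem_erase] at hy
      simp [f, hy]
  let υ : Fin 4 → Fin k := ![τ u, τ u, τ w, τ w]
  have hf (i j : Fin 4) (hi : υ i = τ u) (hj : υ j = τ w) (x : V) :
      Sum.elim υ τ (f i j x) = τ x := by
    by_cases h1 : x = u
    · simp [f, h1, hi]
    by_cases h2 : x = w
    · simp [f, h2, hj, huw.symm]
    · simp [f, h1, h2]
  refine ((h.rename (f 0 2) (hf 0 2 rfl rfl)).and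
    (h.rename (f 1 3) (hf 1 3 rfl rfl))).exs.congr fun a => ?_
  simp only [hsum]
  have hne : ((R.erase u).erase w).Nonempty := ⟨v, by simp [hv, huv.symm, hvw]⟩
  constructor
  · intro ha
    obtain ⟨x, hx⟩ := exists_sum_eq hne (b - a 0 - a 2)
    refine ⟨x, by rw [hx]; ring, ?_⟩
    rw [hx]
    revert ha
    generalize a 0 = a₀, a 1 = a₁, a 2 = a₂, a 3 = a₃
    clear h hsum hx
    revert a₀ a₁ a₂ a₃ b
    decide
  · rintro ⟨x, h1, h2⟩
    revert h1 h2
    generalize a 0 = a₀, a 1 = a₁, a 2 = a₂, a 3 = a₃, ∑ y ∈ (R.erase u).erase w, x y = c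
    clear h hsum
    revert a₀ a₁ a₂ a₃ b c
    decide

/-- Two variables `u`, `v` of equal sort are traded for a shorter equation: with a third variable
`w`, a fresh `c` is set by `x u + x v = x w + c` and takes the place of `w` in the equation over the
rest. -/
theorem sum_canonical [Finite V] [DecidableEq V] [NeZero k] {b : ZMod 2} (R : Finset V)
    (h : Definable S τ fun a : V → ZMod 2 => ∑ v ∈ R, a v = b) :
    Definable (qpp S ∩ CR k) τ fun a : V → ZMod 2 => ∑ v ∈ R, a v = b := by
  induction R using Finset.strongInduction with
  | H R ih =>
  by_cases hτ : Set.InjOn τ R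
  · exact sum_canonical_of_injOn hτ h
  obtain ⟨u, hu, v, hv, hτuv, huv⟩ : ∃ u ∈ R, ∃ v ∈ R, τ u = τ v ∧ u ≠ v := by
    simpa [Set.InjOn] using hτ
  set R' := (R.erase u).erase v with hR'
  have hvR : v ∈ R.erase u := Finset.mem_erase.2 ⟨huv.symm, hv⟩
  have hsum (a : V → ZMod 2) : ∑ y ∈ R, a y = a u + (a v + ∑ y ∈ R', a y) := by
    rw [← Finset.add_sum_erase _ _ hu, ← Finset.add_sum_erase _ _ hvR]
  -- Identifying `v` with `u` cancels both modulo 2, so the shorter equation is definable over `S`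
  -- and the induction applies to it.
  have hsum' (a : V → ZMod 2) :
      ∑ y ∈ R, a (if y = v then u else y) = ∑ y ∈ R', a y := by
    rw [hsum fun y => a (if y = v then u else y), if_neg huv, if_pos rfl, ← add_assoc,
      CharTwo.add_self_eq_zero, zero_add]
    refine Finset.sum_congr rfl fun y hy => ?_
    rw [if_neg (Finset.mem_erase.1 hy).1]
  by_cases hne : R'.Nonempty
  · obtain ⟨w, hw⟩ := hne
    have hw' := hw
    simp only [hR', Finset.mem_erase] at hw'
    have hL := (h.sum_eq_sum_of_sum hu hv hw'.2.2 huv hw'.2.1.symm hw'.1.symm).sum_eq_sum_canonical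
    have hI := ih R' ((Finset.erase_subset _ _).trans_ssubset (Finset.erase_ssubset hu))
      ((h.rename (υ := τ) (fun y => if y = v then u else y) (fun y => by
        split_ifs with hy <;> simp [hy, hτuv])).congr fun a => by rw [hsum'])
    have h1 := hL.rename (υ := fun o : Option V => o.elim (τ w) τ)
      ![some u, some v, some w, none] (by simp [Fin.forall_fin_succ, hτuv])
    have h2 := hI.rename (υ := fun o : Option V => o.elim (τ w) τ)
      (fun y => if y = w then none else some y) (fun y => by split_ifs with hy <;> simp [hy])
    refine (h1.and h2).ex.congr fun a => ?_
    have h3 (c : ZMod 2) : ∑ y ∈ R', (if y = w then none else some y : Option V).elim c a =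
        c + ∑ y ∈ R'.erase w, a y := by
      rw [← Finset.add_sum_erase _ _ hw, if_pos rfl]
      refine congrArg _ (Finset.sum_congr rfl fun y hy => ?_)
      rw [if_neg (Finset.mem_erase.1 hy).1, Option.elim]
    simp only [h3, hsum, Matrix.cons_val, Option.elim_some, Option.elim_none]
    rw [← Finset.add_sum_erase _ _ hw]
    generalize a u = a₀, a v = a₁, a w = a₂, ∑ y ∈ R'.erase w, a y = c
    clear ih h hsum hsum' hI h2 h3
    revert a₀ a₁ a₂ b c
    decide
  · rw [Finset.not_nonempty_iff_eq_empty] at hne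
    simp only [hsum, hne, Finset.sum_empty, add_zero] at h ⊢
    have hb : b = 0 ∨ b = 1 := by clear h ih; revert b; decide
    rcases hb with rfl | rfl
    · exact (eq hτuv).congr fun a => CharTwo.add_eq_zero
    · have h1 := h.proj ![u, v]
      have h2 : Definable S ![τ u, τ u] fun a : Fin 2 → ZMod 2 => a 0 + a 1 = 1 := by
        have h0 : τ ∘ ![u, v] = ![τ u, τ u] := by
          funext i; fin_cases i <;> simp [hτuv]
        rw [h0] at h1
        refine h1.congr fun a => ⟨fun ha => ⟨fun y => if y = u then a 0 else a 1, ?_, ?_⟩, ?_⟩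
        · simpa [huv.symm] using ha
        · simp [Fin.forall_fin_succ, huv.symm]
        · rintro ⟨x, hx, hxa⟩
          rw [← hxa, ← hxa]
          exact hx
      exact (h2.ne_canonical.rename (υ := τ) ![u, v] (by simp [Fin.forall_fin_succ, hτuv])).congr
        fun a => by simp

end Definable

/-! ### Disjunctions of linear equations. -/

namespace Definable

variable {k : ℕ} {S T : Set (SortedRel (ZMod 2) k)} {V : Type} {τ : V → Fin k}
  {P : (V → ZMod 2) → Prop}

/-- A chain of equalities from `p` to `none`, one link per `q ∈ R`: either every link holds, or a
broken one forces its `Q q`. -/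
theorem eq_or_exists_mem [Finite V] {ι : Type} {p : V} {Q : ι → (V → ZMod 2) → Prop}
    (R : Finset ι)
    (h : ∀ q ∈ R, Definable T (Sum.elim τ ![τ p, τ p]) fun a : V ⊕ Fin 2 → ZMod 2 =>
      a (.inr 0) = a (.inr 1) ∨ Q q fun v => a (.inl v)) :
    Definable T (fun o : Option V => o.elim (τ p) τ) fun a : Option V → ZMod 2 =>
      a (some p) = a none ∨ ∃ q ∈ R, Q q fun v => a (some v) := by
  classical
  induction R using Finset.induction_on with
  | empty => exact (eq (u := some p) (v := none) rfl).congr fun a => by simp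
  | insert q R _ ih =>
    have h1 := (ih fun q hq => h q (Finset.mem_insert_of_mem hq)).rename
      (υ := fun o : Option (Option V) => o.elim (τ p) fun o => o.elim (τ p) τ)
      (fun o => o.elim none fun v => some (some v)) (by rintro (_ | v) <;> rfl)
    have h2 := (h q (Finset.mem_insert_self q R)).rename
      (υ := fun o : Option (Option V) => o.elim (τ p) fun o => o.elim (τ p) τ)
      (Sum.elim (fun v => some (some v)) ![none, some none])
      (by rintro (v | i); exacts [rfl, by fin_cases i <;> rfl])
    refine (h1.and h2).ex.congr fun a => ?_
    simp only [Finset.mem_insert, Option.elim_some, Option.elim_none, Sum.elim_inl, Sum.elim_inr,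
      Matrix.cons_val]
    constructor
    · rintro (ha | ⟨r, rfl | hr, ha⟩)
      · exact ⟨_, .inl rfl, .inl ha⟩
      · exact ⟨_, .inl rfl, .inr ha⟩
      · exact ⟨_, .inr ⟨r, hr, ha⟩, .inl rfl⟩
    · rintro ⟨c, h1 | ⟨r, hr, h1⟩, h2 | h2⟩
      · exact .inl (h1.trans h2)
      · exact .inr ⟨q, .inl rfl, h2⟩
      · exact .inr ⟨r, .inr hr, h1⟩
      · exact .inr ⟨q, .inl rfl, h2⟩

/-! Disjunctions of linear equations in echelon form: the equation with pivot `p` is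
`x p + ∑ j ∈ K p, x j = b p`, where `J` is the set of non-pivot variables and `K p ⊆ J`. -/

section Echelon

variable [DecidableEq V] {J : Finset V} {K : V → Finset V} {b : V → ZMod 2}

/-- Universally quantifying the pivots outside `R` deletes their rows: whatever the non-pivots are,
each such pivot has a value that falsifies its row and affects no other. -/
theorem echelon_subset [Finite V] (hK : ∀ p, K p ⊆ J)
    (h : Definable S τ fun x : V → ZMod 2 => ∃ p, p ∉ J ∧ x p + ∑ j ∈ K p, x j = b p)
    {R : Finset V} (hR : ∀ p ∈ R, p ∉ J) :
    Definable S τ fun x : V → ZMod 2 => ∃ p ∈ R, x p + ∑ j ∈ K p, x j = b p := by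
  let f : V → V ⊕ V := fun v => if v ∈ J ∨ v ∈ R then .inl v else .inr v
  have hf (v : V) : Sum.elim τ τ (f v) = τ v := by
    simp only [f]; split_ifs <;> rfl
  have hsum (x y : V → ZMod 2) (p : V) : ∑ j ∈ K p, Sum.elim x y (f j) = ∑ j ∈ K p, x j :=
    Finset.sum_congr rfl fun j hj => by simp [f, hK p hj]
  refine (h.rename f hf).alls.congr fun x => ?_
  simp only [hsum]
  refine ⟨fun ⟨p, hp, hx⟩ y => ⟨p, hR p hp, by simpa [f, hp] using hx⟩, fun hx => ?_⟩
  obtain ⟨p, hpJ, hp⟩ := hx fun p => b p + 1 - ∑ j ∈ K p, x j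
  by_cases hpR : p ∈ R
  · exact ⟨p, hpR, by simpa [f, hpR] using hp⟩
  · simp [f, hpR, hpJ] at hp

/-- Impose the two rows for all four choices of pivot values and quantify the other variables
existentially. If `a 0 ≠ a 1` and `a 2 ≠ a 3`, some choice violates both rows; if one pair is equal,
its nonempty sum can be set to satisfy its row throughout. -/
theorem eq_or_eq_of_echelon [Finite V] (hK : ∀ p, K p ⊆ J)
    (h : Definable S τ fun x : V → ZMod 2 => ∃ p, p ∉ J ∧ x p + ∑ j ∈ K p, x j = b p)
    {p q : V} (hp : p ∉ J) (hq : q ∉ J) (hpq : p ≠ q) (hKp : (K p).Nonempty)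
    (hKq : (K q).Nonempty) :
    Definable S ![τ p, τ p, τ q, τ q] fun a : Fin 4 → ZMod 2 => a 0 = a 1 ∨ a 2 = a 3 := by
  have h' := h.echelon_subset hK (R := {p, q}) (by simp [hp, hq])
  let f (i j : Fin 4) : V → Fin 4 ⊕ V := fun x =>
    if x = p then .inl i else if x = q then .inl j else .inr x
  have hsum (i j : Fin 4) (a : Fin 4 → ZMod 2) (x : V → ZMod 2) (r : V) :
      ∑ y ∈ K r, Sum.elim a x (f i j y) = ∑ y ∈ K r, x y :=
    Finset.sum_congr rfl fun y hy => by
      have hyJ := hK r hy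
      simp [f, ne_of_mem_of_not_mem hyJ hp, ne_of_mem_of_not_mem hyJ hq]
  have hfp (i j : Fin 4) : f i j p = .inl i := by simp [f]
  have hfq (i j : Fin 4) : f i j q = .inl j := by simp [f, hpq.symm]
  let υ : Fin 4 → Fin k := ![τ p, τ p, τ q, τ q]
  have hf (i j : Fin 4) (hi : υ i = τ p) (hj : υ j = τ q) (x : V) :
      Sum.elim υ τ (f i j x) = τ x := by
    by_cases h1 : x = p
    · simp [h1, hfp, hi]
    by_cases h2 : x = q
    · simp [h2, hfq, hj]
    · simp [f, h1, h2]
  refine ((h'.rename (f 0 2) (hf 0 2 rfl rfl)).and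
    ((h'.rename (f 0 3) (hf 0 3 rfl rfl)).and
    ((h'.rename (f 1 2) (hf 1 2 rfl rfl)).and
    (h'.rename (f 1 3) (hf 1 3 rfl rfl))))).exs.congr fun a => ?_
  simp only [Finset.mem_insert, Finset.mem_singleton, exists_eq_or_imp, exists_eq_left, hsum, hfp,
    hfq, Sum.elim_inl]
  constructor
  · rintro (ha | ha)
    · obtain ⟨x, hx⟩ := exists_sum_eq hKp (b p - a 0)
      exact ⟨x, by simp [hx, ← ha]⟩
    · obtain ⟨x, hx⟩ := exists_sum_eq hKq (b q - a 2)
      exact ⟨x, by simp [hx, ← ha]⟩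
  · rintro ⟨x, hx⟩
    revert hx
    generalize ∑ y ∈ K p, x y = c, ∑ y ∈ K q, x y = d, b p = b₀, b q = b₁, a 0 = a₀, a 1 = a₁,
      a 2 = a₂, a 3 = a₃
    clear h h' hsum
    revert c d b₀ b₁ a₀ a₁ a₂ a₃
    decide

theorem eq_or_const_of_echelon [Finite V] (hK : ∀ p, K p ⊆ J)
    (h : Definable S τ fun x : V → ZMod 2 => ∃ p, p ∉ J ∧ x p + ∑ j ∈ K p, x j = b p)
    {p q : V} (hp : p ∉ J) (hq : q ∉ J) (hpq : p ≠ q) (hKp : (K p).Nonempty)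
    (hKq : K q = ∅) :
    Definable S ![τ p, τ p, τ q] fun a : Fin 3 → ZMod 2 => a 0 = a 1 ∨ a 2 = b q := by
  have h' := h.echelon_subset hK (R := {p, q}) (by simp [hp, hq])
  let f (i : Fin 3) : V → Fin 3 ⊕ V := fun x =>
    if x = p then .inl i else if x = q then .inl 2 else .inr x
  have hsum (i : Fin 3) (a : Fin 3 → ZMod 2) (x : V → ZMod 2) (r : V) :
      ∑ y ∈ K r, Sum.elim a x (f i y) = ∑ y ∈ K r, x y :=
    Finset.sum_congr rfl fun y hy => by
      have hyJ := hK r hy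
      simp [f, ne_of_mem_of_not_mem hyJ hp, ne_of_mem_of_not_mem hyJ hq]
  have hfp (i : Fin 3) : f i p = .inl i := by simp [f]
  have hfq (i : Fin 3) : f i q = .inl 2 := by simp [f, hpq.symm]
  let υ : Fin 3 → Fin k := ![τ p, τ p, τ q]
  have hf (i : Fin 3) (hi : υ i = τ p) (x : V) : Sum.elim υ τ (f i x) = τ x := by
    by_cases h1 : x = p
    · simp [h1, hfp, hi]
    by_cases h2 : x = q
    · simp [h2, hfq, υ]
    · simp [f, h1, h2]
  refine ((h'.rename (f 0) (hf 0 rfl)).and (h'.rename (f 1) (hf 1 rfl))).exs.congr fun a => ?_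
  simp only [Finset.mem_insert, Finset.mem_singleton, exists_eq_or_imp, exists_eq_left, hsum, hfp,
    hfq, Sum.elim_inl, hKq, Finset.sum_empty, add_zero]
  constructor
  · rintro (ha | ha)
    · obtain ⟨x, hx⟩ := exists_sum_eq hKp (b p - a 0)
      exact ⟨x, by simp [hx, ← ha]⟩
    · exact ⟨0, by simp [ha]⟩
  · rintro ⟨x, hx⟩
    revert hx
    generalize ∑ y ∈ K p, x y = c, b p = b₀, b q = b₁, a 0 = a₀, a 1 = a₁, a 2 = a₂
    clear h h' hsum
    revert c b₀ b₁ a₀ a₁ a₂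
    decide

theorem row_canonical [Finite V] [NeZero k] (hK : ∀ p, K p ⊆ J)
    (h : Definable S τ fun x : V → ZMod 2 => ∃ p, p ∉ J ∧ x p + ∑ j ∈ K p, x j = b p)
    {p : V} (hp : p ∉ J) :
    Definable (qpp S ∩ CR k) τ fun x : V → ZMod 2 => x p + ∑ j ∈ K p, x j = b p := by
  have hpK : p ∉ K p := fun h => hp (hK p h)
  have h1 := h.echelon_subset hK (R := {p}) (by simp [hp])
  simp only [Finset.mem_singleton, exists_eq_left, ← Finset.sum_insert hpK] at h1 ⊢
  exact sum_canonical _ h1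

/-- Replace the pivot `x p` by a fresh `c` satisfying row `p` outright, and require `x p = c` or one
of the other rows. The latter is a chain whose links are `y = z ∨ row q`; for nonempty `K q` a link
is again built by replacing the pivot `x q`. -/
theorem echelon_canonical_of_nonempty [Fintype V] [NeZero k] (hK : ∀ p, K p ⊆ J)
    (h : Definable S τ fun x : V → ZMod 2 => ∃ p, p ∉ J ∧ x p + ∑ j ∈ K p, x j = b p)
    {p : V} (hp : p ∉ J) (hKp : (K p).Nonempty) :
    Definable (qpp S ∩ CR k) τ
      fun x : V → ZMod 2 => ∃ p, p ∉ J ∧ x p + ∑ j ∈ K p, x j = b p := by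
  have hstep : ∀ q ∈ Jᶜ.erase p, Definable (qpp S ∩ CR k) (Sum.elim τ ![τ p, τ p])
      fun a : V ⊕ Fin 2 → ZMod 2 => a (.inr 0) = a (.inr 1) ∨
        a (.inl q) + ∑ j ∈ K q, a (.inl j) = b q := by
    intro q hq
    obtain ⟨hqp, hqJ⟩ : q ≠ p ∧ q ∉ J := by simpa using hq
    rcases (K q).eq_empty_or_nonempty with hKq | hKq
    · exact ((h.eq_or_const_of_echelon hK hp hqJ hqp.symm hKp hKq).eq_or_const_canonical.rename
        ![.inr 0, .inr 1, .inl q] (by simp [Fin.forall_fin_succ])).congr fun a => by simp [hKq]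
    · have h1 := (h.eq_or_eq_of_echelon hK hp hqJ hqp.symm hKp hKq).eq_or_eq_canonical.rename
        (υ := fun o : Option (V ⊕ Fin 2) => o.elim (τ q) (Sum.elim τ ![τ p, τ p]))
        ![some (.inr 0), some (.inr 1), some (.inl q), none] (by simp [Fin.forall_fin_succ])
      have h2 := (h.row_canonical hK hqJ).rename
        (υ := fun o : Option (V ⊕ Fin 2) => o.elim (τ q) (Sum.elim τ ![τ p, τ p]))
        (fun v => if v = q then none else some (.inl v))
        (fun v => by split_ifs with hv <;> simp [hv])
      refine (h1.and h2).ex.congr fun a => ?_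
      have hsum (c : ZMod 2) : ∑ j ∈ K q, (if j = q then none else some (.inl j) :
          Option (V ⊕ Fin 2)).elim c a = ∑ j ∈ K q, a (.inl j) :=
        Finset.sum_congr rfl fun j hj => by
          rw [if_neg (ne_of_mem_of_not_mem (hK q hj) hqJ), Option.elim_some]
      simp only [hsum, Matrix.cons_val, Option.elim_some, Option.elim_none, if_pos]
      constructor
      · rintro (ha | ha)
        · exact ⟨b q - ∑ j ∈ K q, a (.inl j), .inl ha, by ring⟩
        · exact ⟨a (.inl q), .inr rfl, ha⟩
      · rintro ⟨c, ha | ha, hc⟩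
        · exact .inl ha
        · exact .inr (ha ▸ hc)
  have h1 := eq_or_exists_mem _ hstep
    (Q := fun q a => a q + ∑ j ∈ K q, a j = b q)
  have h2 := (h.row_canonical hK hp).rename (υ := fun o : Option V => o.elim (τ p) τ)
    (fun v => if v = p then none else some v) (fun v => by split_ifs with hv <;> simp [hv])
  refine (h1.and h2).ex.congr fun a => ?_
  have hsum (c : ZMod 2) : ∑ j ∈ K p, (if j = p then none else some j :
      Option V).elim c a = ∑ j ∈ K p, a j :=
    Finset.sum_congr rfl fun j hj => by
      rw [if_neg (ne_of_mem_of_not_mem (hK p hj) hp), Option.elim_some]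
  simp only [hsum, Option.elim_some, Option.elim_none, if_pos, Finset.mem_erase,
    Finset.mem_compl]
  constructor
  · rintro ⟨q, hq, ha⟩
    by_cases hqp : q = p
    · subst hqp
      exact ⟨a q, .inl rfl, ha⟩
    · exact ⟨b p - ∑ j ∈ K p, a j, .inr ⟨q, ⟨hqp, hq⟩, ha⟩, by ring⟩
  · rintro ⟨c, ha | ⟨q, ⟨-, hq⟩, ha⟩, hc⟩
    · exact ⟨p, hp, ha ▸ hc⟩
    · exact ⟨q, hq, ha⟩

/-- Opposite literals of one sort are split by a fresh `c`: `c = 0 ∨ x q = 1`, together with a chain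
expressing that `x p = c` or another literal holds. -/
theorem mixed_clause_canonical [Finite V] [NeZero k] {R : Finset V}
    (h : ∀ R' ⊆ R, Definable S τ fun x : V → ZMod 2 => ∃ v ∈ R', x v = b v) {p q : V}
    (hp : p ∈ R) (hq : q ∈ R) (hτ : τ p = τ q) (hbp : b p = 0) (hbq : b q = 1) :
    Definable (qpp S ∩ CR k) τ fun x : V → ZMod 2 => ∃ v ∈ R, x v = b v := by
  have hpq : p ≠ q := by rintro rfl; simp [hbp] at hbq
  have hle : Definable S ![τ p, τ p] fun a : Fin 2 → ZMod 2 => a 0 = 0 ∨ a 1 = 1 := by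
    have h1 := (h {p, q} (by simp [Finset.insert_subset_iff, hp, hq])).rename
      (υ := Sum.elim ![τ p, τ p] τ)
      (fun v => if v = p then .inl 0 else if v = q then .inl 1 else .inr v)
      (fun v => by split_ifs <;> simp_all)
    exact h1.exs.congr fun a => by simp [hpq.symm, hbp, hbq]
  have hstep : ∀ u ∈ (R.erase p).erase q, Definable (qpp S ∩ CR k) (Sum.elim τ ![τ p, τ p])
      fun a : V ⊕ Fin 2 → ZMod 2 => a (.inr 0) = a (.inr 1) ∨ a (.inl u) = b u := by
    intro u hu
    simp only [Finset.mem_erase] at hu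
    have h0 := h {p, q, u} (by simp [Finset.insert_subset_iff, hp, hq, hu])
    have h1 := h0.rename (υ := Sum.elim ![τ p, τ p, τ u] τ)
      (fun v => if v = p then .inl 0 else if v = q then .inl 1 else if v = u then .inl 2
        else .inr v)
      (fun v => by split_ifs <;> simp_all)
    have h2 := h0.rename (υ := Sum.elim ![τ p, τ p, τ u] τ)
      (fun v => if v = p then .inl 1 else if v = q then .inl 0 else if v = u then .inl 2
        else .inr v)
      (fun v => by split_ifs <;> simp_all)
    -- The two orders of the first two arguments give both implications between them, hence
    -- equality.
    have h3 : Definable S ![τ p, τ p, τ u] fun a : Fin 3 → ZMod 2 => a 0 = a 1 ∨ a 2 = b u := by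
      refine (h1.and h2).exs.congr fun a => ?_
      simp only [Finset.mem_insert, Finset.mem_singleton, exists_eq_or_imp, exists_eq_left,
        if_pos, if_neg hpq.symm, if_neg hu.1, if_neg hu.2.1, Sum.elim_inl, hbp, hbq, exists_const]
      generalize a 0 = a₀, a 1 = a₁, a 2 = a₂, b u = c
      clear h h0 h1 h2 hle
      revert a₀ a₁ a₂ c
      decide
    exact (h3.eq_or_const_canonical.rename ![.inr 0, .inr 1, .inl u]
      (by simp [Fin.forall_fin_succ])).congr fun a => by simp
  have h1 := eq_or_exists_mem _ hstep (Q := fun u a => a u = b u)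
  have h2 := hle.le_canonical.rename (υ := fun o : Option V => o.elim (τ p) τ) ![none, some q]
    (by simp [Fin.forall_fin_succ, hτ])
  refine (h1.and h2).ex.congr fun a => ?_
  simp only [Finset.mem_erase, Matrix.cons_val, Option.elim_some, Option.elim_none]
  constructor
  · rintro ⟨u, hu, ha⟩
    by_cases hup : u = p
    · subst hup
      exact ⟨a u, .inl rfl, .inl (ha.trans hbp)⟩
    by_cases huq : u = q
    · subst huq
      exact ⟨a p, .inl rfl, .inr (ha.trans hbq)⟩
    · exact ⟨0, .inr ⟨u, ⟨huq, hup, hu⟩, ha⟩, .inl rfl⟩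
  · rintro ⟨c, rfl | ⟨u, ⟨-, -, hu⟩, ha⟩, hc⟩
    · rcases hc with hc | hc
      · exact ⟨p, hp, hc.trans hbp.symm⟩
      · exact ⟨q, hq, hc.trans hbq.symm⟩
    · exact ⟨u, hu, ha⟩

theorem echelon_canonical [Fintype V] [NeZero k] (hK : ∀ p, K p ⊆ J)
    (h : Definable S τ fun x : V → ZMod 2 => ∃ p, p ∉ J ∧ x p + ∑ j ∈ K p, x j = b p) :
    Definable (qpp S ∩ CR k) τ
      fun x : V → ZMod 2 => ∃ p, p ∉ J ∧ x p + ∑ j ∈ K p, x j = b p := by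
  by_cases hne : ∃ p, p ∉ J ∧ (K p).Nonempty
  · obtain ⟨p, hp, hKp⟩ := hne
    exact h.echelon_canonical_of_nonempty hK hp hKp
  push Not at hne
  have hclause (R : Finset V) (hR : R ⊆ Jᶜ) (x : V → ZMod 2) :
      (∃ p ∈ R, x p + ∑ j ∈ K p, x j = b p) ↔ ∃ p ∈ R, x p = b p :=
    exists_congr fun p => and_congr_right fun hp => by
      rw [hne p (Finset.mem_compl.1 (hR hp)), Finset.sum_empty, add_zero]
  have hsub : ∀ R ⊆ Jᶜ, Definable S τ fun x : V → ZMod 2 => ∃ v ∈ R, x v = b v :=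
    fun R hR => (h.echelon_subset hK fun p hp => Finset.mem_compl.1 (hR hp)).congr
      fun x => (hclause R hR x).symm
  have key : Definable (qpp S ∩ CR k) τ fun x : V → ZMod 2 => ∃ v ∈ Jᶜ, x v = b v := by
    by_cases hb : ∀ u ∈ Jᶜ, ∀ v ∈ Jᶜ, τ u = τ v → b u = b v
    · exact clause_canonical hb (hsub _ subset_rfl)
    push Not at hb
    obtain ⟨u, hu, v, hv, hτ, hb⟩ := hb
    have hcases : b u = 0 ∧ b v = 1 ∨ b v = 0 ∧ b u = 1 := by
      clear h hclause hsub
      revert hb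
      generalize b u = c, b v = d
      revert c d
      decide
    rcases hcases with ⟨h0, h1⟩ | ⟨h0, h1⟩
    · exact mixed_clause_canonical hsub hu hv hτ h0 h1
    · exact mixed_clause_canonical hsub hv hu hτ.symm h0 h1
  refine key.congr fun x => ?_
  rw [← hclause _ subset_rfl]
  simp

end Echelon

end Definable

/-! ### Echelon form of a subgroup. -/

/-- A subgroup of `𝔽₂^V` is the solution set of a system of linear equations in echelon form. -/
theorem exists_echelon_form {V : Type} [Fintype V] [DecidableEq V]
    (D : AddSubgroup (V → ZMod 2)) :
    ∃ (J : Finset V) (K : V → Finset V), (∀ p, K p ⊆ J) ∧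
      ∀ d, d ∈ D ↔ ∀ p ∉ J, d p + ∑ j ∈ K p, d j = 0 := by
  classical
  -- `J` is a largest set of coordinates onto which `D` projects surjectively. By maximality an
  -- element of `D` is determined by its values on `J`.
  obtain ⟨J, hJ, hmax⟩ := (Finset.univ.filter fun J : Finset V =>
    ∀ y : V → ZMod 2, ∃ d ∈ D, ∀ j ∈ J, d j = y j).exists_max_image Finset.card
      ⟨∅, by simpa using ⟨0, D.zero_mem⟩⟩
  simp only [Finset.mem_filter, Finset.mem_univ, true_and] at hJ hmax
  have hzero : ∀ d ∈ D, (∀ j ∈ J, d j = 0) → d = 0 := by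
    intro d hd hdJ
    funext p
    by_contra hp
    have hpJ : p ∉ J := fun h => hp (hdJ p h)
    refine absurd (hmax (insert p J) fun y => ?_) (by simp [Finset.card_insert_of_notMem hpJ])
    obtain ⟨e, he, hey⟩ := hJ y
    by_cases hep : e p = y p
    · exact ⟨e, he, by simpa [hep] using hey⟩
    · refine ⟨e + d, D.add_mem he hd, ?_⟩
      have h1 : e p + d p = y p := by
        rw [ZMod.two_eq_add_one_of_ne hp, ZMod.two_eq_add_one_of_ne (Ne.symm hep)]
        simp
      simp only [Finset.mem_insert, forall_eq_or_imp, Pi.add_apply, h1, true_and]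
      intro j hj
      rw [hey j hj, hdJ j hj, add_zero]
  choose l hlD hlJ using fun i => hJ (Pi.single i 1)
  have hone (c : ZMod 2) (hc : c ≠ 0) : c = 1 := by revert c; decide
  have hcoord (d : V → ZMod 2) (p : V) :
      (∑ j ∈ J, d j • l j) p = ∑ j ∈ J with l j p ≠ 0, d j := by
    rw [Finset.sum_apply, Finset.sum_filter]
    refine Finset.sum_congr rfl fun j _ => ?_
    split_ifs with h
    · simp [hone _ h]
    · simp [not_not.1 h]
  have hmem (d : V → ZMod 2) : ∑ j ∈ J, d j • l j ∈ D := by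
    refine D.sum_mem fun j _ => ?_
    by_cases h : d j = 0
    · simp [h, D.zero_mem]
    · simpa [hone _ h] using hlD j
  have hcoordJ (d : V → ZMod 2) (p : V) (hp : p ∈ J) : (∑ j ∈ J, d j • l j) p = d p := by
    rw [Finset.sum_apply, Finset.sum_eq_single p]
    · simp [hlJ p p hp]
    · intro j _ hjp
      simp [hlJ j p hp, hjp.symm]
    · exact fun h => absurd hp h
  refine ⟨J, fun p => J.filter fun j => l j p ≠ 0, fun p => Finset.filter_subset _ _,
    fun d => ⟨fun hd p _ => ?_, fun h => ?_⟩⟩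
  · have h1 := hzero _ (D.add_mem hd (hmem d)) fun j hj => by
      rw [Pi.add_apply, hcoordJ d j hj, CharTwo.add_self_eq_zero]
    rw [← hcoord]
    exact congrFun h1 p
  · convert hmem d using 1
    funext p
    by_cases hp : p ∈ J
    · rw [hcoordJ d p hp]
    · rw [hcoord]
      exact CharTwo.add_eq_zero.1 (h p hp)

/-! ### Maximal predicates and separation. -/

namespace Definable

variable {k : ℕ} {S : Set (SortedRel (ZMod 2) k)} {V : Type} {τ : V → Fin k}
  {P : (V → ZMod 2) → Prop}

/-- If `P` is maximal among the definable predicates that omit `α`, and changing any one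
coordinate of `α` leads into `P`, then `P` is invariant under translation by `γ + α` for each `γ`
outside of `P`. -/
theorem translation_of_maximal [Fintype V] [DecidableEq V] [NeZero k] (h : Definable S τ P)
    {α : V → ZMod 2} (hflip : ∀ v, P (Function.update α v (α v + 1)))
    (hα : ¬ P α)
    (hmax : ∀ Q : (V → ZMod 2) → Prop, Definable S τ Q → ¬ Q α → (∀ x, P x → Q x) →
      ∀ x, Q x → P x)
    {γ : V → ZMod 2} (hγ : ¬ P γ) {x : V → ZMod 2} (hx : P x) : P (x + γ + α) := by
  -- A point `y` encodes a unary map `y (v, ·)` for each coordinate; `Pres` says that the family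
  -- preserves `P`.
  let Pres : (V × ZMod 2 → ZMod 2) → Prop := fun y => ∀ s, P s → P fun v => y (v, s v)
  have hPres : Definable S (fun v : V × ZMod 2 => τ v.1) Pres :=
    forall_finite fun s => imp_const fun _ => h.rename (fun v => (v, s v)) fun _ => rfl
  have hQ := hPres.proj fun v => (v, γ v)
  -- The images of `γ` under such families form a definable predicate. It contains `P` (constant
  -- maps) and `γ` (identity maps), so by maximality it contains `α`.
  obtain ⟨y, hy, hyα⟩ : ∃ y, Pres y ∧ ∀ v, y (v, γ v) = α v := by
    by_contra hQα
    exact hγ (hmax _ hQ hQα (fun x hx => ⟨fun v => x v.1, fun _ _ => hx, fun _ => rfl⟩) γ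
      ⟨fun v => v.2, fun _ hs => hs, fun _ => rfl⟩)
  have hinj : ∀ v, y (v, γ v + 1) ≠ α v := by
    intro v hv
    -- If `y (v, ·)` were constant, `y` would send the flip of `α` at `v` to `z`, and `z` to `α`,
    -- forcing `P α`.
    let z : V → ZMod 2 := fun u => if y (u, γ u + 1) = α u then α u else γ u
    have hyz : (fun u => y (u, z u)) = α := by
      funext u
      simp only [z]
      split_ifs with hu
      · rcases ZMod.two_eq_or_eq_of_ne (a := γ u) (b := γ u + 1) (by simp) (α u) with h1 | h1
        · rw [h1, hyα, h1]
        · rw [h1, hu, h1]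
      · exact hyα u
    refine hα (hyz ▸ hy z ?_)
    convert hy _ (hflip v) using 1
    funext u
    simp only [z]
    split_ifs with hu
    · rcases ZMod.two_eq_or_eq_of_ne (a := γ u) (b := γ u + 1) (by simp)
        (Function.update α v (α v + 1) u) with h1 | h1
      · rw [h1, hyα]
      · rw [h1, hu]
    · have huv : u ≠ v := by rintro rfl; exact hu hv
      rw [Function.update_of_ne huv]
      by_cases h1 : α u = γ u
      · rw [h1, hyα, h1]
      · have h2 := ZMod.two_eq_add_one_of_ne hu
        rw [ZMod.two_eq_add_one_of_ne h1, h2, ZMod.two_eq_add_one_of_ne h1]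
        simp [add_assoc, CharTwo.add_self_eq_zero]
  -- Each `y (v, ·)` is thus a bijection taking `γ v` to `α v`, that is, translation by `γ v + α v`.
  convert hy x hx using 1
  funext v
  rcases ZMod.two_eq_or_eq_of_ne (a := γ v) (b := γ v + 1) (by simp) (x v) with h1 | h1
  · simp [h1, hyα, CharTwo.add_self_eq_zero]
  · rw [h1, ZMod.two_eq_add_one_of_ne (hinj v)]
    simp only [Pi.add_apply, h1]
    linear_combination CharTwo.add_self_eq_zero (γ v)

/-- Translation invariance makes the complement of `P` a coset `α + D`. Its echelon equations hold
exactly outside `P`, so `P` says that one of them fails, which modulo 2 is the equation with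
constant shifted by `1`. -/
theorem canonical_of_maximal [Fintype V] [NeZero k] [DecidableEq V] (h : Definable S τ P)
    {α : V → ZMod 2} (hflip : ∀ v, P (Function.update α v (α v + 1))) (hα : ¬ P α)
    (hmax : ∀ Q : (V → ZMod 2) → Prop, Definable S τ Q → ¬ Q α → (∀ x, P x → Q x) →
      ∀ x, Q x → P x) : Definable (qpp S ∩ CR k) τ P := by
  have hself (d : V → ZMod 2) : d + d = 0 := by
    funext v; exact CharTwo.add_self_eq_zero (d v)
  have htrans {d x : V → ZMod 2} (hd : ¬ P (α + d)) (hx : P x) : P (x + d) := by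
    have h1 := h.translation_of_maximal hflip hα hmax hd hx
    rwa [show x + (α + d) + α = x + d + (α + α) by abel, hself, add_zero] at h1
  let D : AddSubgroup (V → ZMod 2) :=
    { carrier := {d | ¬ P (α + d)}
      zero_mem' := by simpa using hα
      add_mem' := fun {d e} hd he hde => he (by
        have h1 := htrans hd hde
        rwa [show α + (d + e) + d = α + e + (d + d) by abel, hself, add_zero] at h1)
      neg_mem' := fun {d} hd => by rwa [neg_eq_of_add_eq_zero_left (hself d)] }
  have hD (d : V → ZMod 2) : d ∈ D ↔ ¬ P (α + d) := Iff.rfl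
  obtain ⟨J, K, hK, hJ⟩ := exists_echelon_form D
  have hP (x : V → ZMod 2) : P x ↔
      ∃ p, p ∉ J ∧ x p + ∑ j ∈ K p, x j = α p + ∑ j ∈ K p, α j + 1 := by
    have h1 := (hD (α + x)).symm.trans (hJ (α + x))
    rw [← add_assoc, hself, zero_add] at h1
    rw [← not_iff_not, h1]
    push Not
    refine forall₂_congr fun p _ => ?_
    simp only [Pi.add_apply, Finset.sum_add_distrib]
    generalize ∑ j ∈ K p, α j = a, ∑ j ∈ K p, x j = b, α p = c, x p = d
    clear h1
    revert a b c d
    decide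
  exact (echelon_canonical hK (h.congr fun x => (hP x).symm)).congr hP

theorem exists_canonical_separating [NeZero k] (n : ℕ) : ∀ {V : Type} [Finite V]
    {τ : V → Fin k} {P : (V → ZMod 2) → Prop} {α : V → ZMod 2}, Nat.card V = n →
    Definable S τ P → ¬ P α →
      ∃ Q, Definable (qpp S ∩ CR k) τ Q ∧ (∀ x, P x → Q x) ∧ ¬ Q α := by
  classical
  induction n using Nat.strong_induction_on with
  | _ n ih =>
  intro V _ τ P α hn h hα
  have := Fintype.ofFinite V
  by_cases hflip : ∀ v, P (Function.update α v (α v + 1))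
  -- Enlarging `P` to `M` keeps all neighbours of `α` inside.
  · obtain ⟨M, hPM, hM⟩ := (Set.toFinite {Q : Set (V → ZMod 2) | Definable S τ (· ∈ Q) ∧
      α ∉ Q}).exists_le_maximal (a := {x | P x}) ⟨h, hα⟩
    refine ⟨(· ∈ M), canonical_of_maximal hM.prop.1 (fun v => hPM (hflip v)) hM.prop.2 ?_,
      fun x hx => hPM hx, hM.prop.2⟩
    exact fun Q hQ hQα hMQ => hM.le_of_ge (y := {x | Q x}) ⟨hQ, hQα⟩ hMQ
  · push Not at hflip
    obtain ⟨v, hv⟩ := hflip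
    -- Both extensions of `α` restricted to the coordinates other than `v` lie outside `P`, so the
    -- projection omits this restriction.
    have hproj := h.proj (Subtype.val : {u // u ≠ v} → V)
    have hprojα : ¬ ∃ x, P x ∧ ∀ u : {u // u ≠ v}, x u = α u := by
      rintro ⟨x, hx, hxα⟩
      rcases ZMod.two_eq_or_eq_of_ne (a := α v) (b := α v + 1) (by simp) (x v) with h1 | h1
      · refine hα ?_
        convert hx using 1
        funext u
        by_cases huv : u = v
        · rw [huv, h1]
        · exact (hxα ⟨u, huv⟩).symm
      · refine hv ?_
        convert hx using 1
        funext u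
        by_cases huv : u = v
        · subst huv; simp [h1]
        · simpa [huv] using (hxα ⟨u, huv⟩).symm
    obtain ⟨Q, hQ, hPQ, hQα⟩ := ih (Nat.card {u // u ≠ v})
      (hn ▸ Finite.card_subtype_lt (p := (· ≠ v)) (x := v) (by simp))
      (P := fun a => ∃ x, P x ∧ ∀ u : {u // u ≠ v}, x u = a u) (α := fun u => α u) rfl hproj hprojα
    exact ⟨_, hQ.rename Subtype.val fun _ => rfl, fun x hx => hPQ _ ⟨x, hx, fun _ => rfl⟩, hQα⟩

theorem inter_CR [NeZero k] [Finite V] (h : Definable S τ P) :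
    Definable (qpp S ∩ CR k) τ P := by
  choose Q hQ hPQ hQα using fun α : {α // ¬ P α} =>
    exists_canonical_separating (S := S) _ rfl h α.2
  exact (forall_finite hQ).congr fun x => ⟨fun hx α => hPQ α x hx,
    fun hx => by_contra fun hPx => hQα ⟨x, hPx⟩ (hx ⟨x, hPx⟩)⟩

end Definable

theorem theorem2 (k : ℕ) (hk : 1 ≤ k) :
    (∀ S : Set (SortedRel (ZMod 2) k), qpp S = qpp (qpp S ∩ CR k)) ∧
      ∀ C : Set (SortedRel (ZMod 2) k), IsQuantifiedRelClone C → C = qpp (C ∩ CR k) := by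
  have : NeZero k := ⟨by omega⟩
  have main (S : Set (SortedRel (ZMod 2) k)) : qpp S = qpp (qpp S ∩ CR k) :=
    Set.Subset.antisymm
      (fun _ hρ => Definable.mem_qpp_iff.2 (Definable.mem_qpp_iff.1 hρ).inter_CR)
      (qpp_subset_of_subset_qpp Set.inter_subset_left)
  refine ⟨main, fun C hC => ?_⟩
  have h1 := main C
  rwa [show qpp C = C from hC] at h1
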